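/- Let $n\geqslant 1$, $[n]=\{1,\ldots,n\}$ and $\pm[n]=\{-n,\ldots,-1,1,\ldots,n\}$. Let $\mathfrak{S}_n^B$ be the group of signed permutations, i.e. of the permutations $\pi$ of $\pm[n]$ with $\pi(-i)=-\pi(i)$ for all $i\in[n]$. For $\pi\in\mathfrak{S}_n^B$ put $\pi(0)=0$ and let $$\operatorname{des}_A(\pi)=\#\{i\in\{1,\ldots,n-1\}\mid \pi(i)>\pi(i+1)\},\quad \operatorname{des}_B(\pi)=\#\{i\in\{0,1,\ldots,n-1\}\mid \pi(i)>\pi(i+1)\},$$ $$\operatorname{neg}(\pi)=\#\{i\in[n]\mid \pi(i)<0\}.$$ Let $\mathcal{Q}_{n+1}^{(0)}$ be the set of Stirling permutations of the multiset $\{1,2^2,3^2,\ldots,(n+1)^2\}$, in which $1$ appears once and each of $2,\ldots,n+1$ appears twice: the words $\sigma=\sigma_1\sigma_2\cdots\sigma_{2n+1}$ that arrange this multiset and satisfy $\sigma_s>\sigma_i$ whenever $i<s<j$ and $\sigma_i=\sigma_j$. For $\sigma\in\mathcal{Q}_{n+1}^{(0)}$ put $\sigma_0=0$ and let $$\operatorname{lap}(\sigma)=\#\{i\mid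 1\leqslant i\leqslant 2n,\ \sigma_{i-1}<\sigma_i=\sigma_{i+1}\},\quad \operatorname{ap}(\sigma)=\#\{i\mid 2\leqslant i\leqslant 2n,\ \sigma_{i-1}<\sigma_i=\sigma_{i+1}\},$$ and let $\operatorname{even}(\sigma)$ be the number of values $k\in\{2,\ldots,n+1\}$ whose first (leftmost) appearance in $\sigma$ is at an even position, positions being numbered $1,\ldots,2n+1$. Then $$\sum_{\pi\in\mathfrak{S}_n^B}x^{\operatorname{des}_A(\pi)+1}y^{\operatorname{des}_B(\pi)}q^{\operatorname{neg}(\pi)}=\sum_{\sigma\in\mathcal{Q}_{n+1}^{(0)}}x^{\operatorname{lap}(\sigma)}y^{\operatorname{ap}(\sigma)}q^{\operatorname{even}(\sigma)}$$ as polynomials in the commuting indeterminates $x,y,q$ (equivalently, for all elements $x,y,q$ of any commutative semiring). -/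

import Mathlib

/-- The set `±[n] = {-n, …, -1, 1, …, n}`. -/
abbrev PlusMinus (n : ℕ) : Type :=
  {k : ℤ // k ∈ (Finset.Icc (-n : ℤ) n).erase 0}

/-- The map `i ↦ -i` of `±[n]`. -/
def PlusMinus.bar {n : ℕ} (k : PlusMinus n) : PlusMinus n :=
  ⟨-k.1, by
    have h := k.2
    simp only [Finset.mem_erase, Finset.mem_Icc] at h ⊢
    omega⟩

/-- The hyperoctahedral group: all permutations `π` of `±[n]` with `π (-i) = -π i`. -/
noncomputable def signedPermutations (n : ℕ) : Finset (Equiv.Perm (PlusMinus n)) :=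
  Finset.univ.filter fun π => ∀ i : PlusMinus n, π i.bar = (π i).bar

/-- The letter `π(i)` of the one-line word `π(1) ⋯ π(n)`, for `1 ≤ i ≤ n`;
it is `0` for all other `i`, which contains the convention `π(0) = 0`. -/
def signedEntry {n : ℕ} (π : Equiv.Perm (PlusMinus n)) (i : ℕ) : ℤ :=
  if h : 1 ≤ i ∧ i ≤ n then
    (π ⟨(i : ℤ), by simp only [Finset.mem_erase, Finset.mem_Icc]; omega⟩ : ℤ)
  else 0

/-- Type `A` descents: the `i ∈ {1, …, n - 1}` with `π(i) > π(i + 1)`. -/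
def desA {n : ℕ} (π : Equiv.Perm (PlusMinus n)) : ℕ :=
  ((Finset.Ico 1 n).filter fun i => signedEntry π i > signedEntry π (i + 1)).card

/-- Type `B` descents: the `i ∈ {0, 1, …, n - 1}` with `π(i) > π(i + 1)`, where `π(0) = 0`. -/
def desB {n : ℕ} (π : Equiv.Perm (PlusMinus n)) : ℕ :=
  ((Finset.range n).filter fun i => signedEntry π i > signedEntry π (i + 1)).card

/-- The number of negative entries of `π(1) ⋯ π(n)`. -/
def negCount {n : ℕ} (π : Equiv.Perm (PlusMinus n)) : ℕ :=
  ((Finset.Icc 1 n).filter fun i => signedEntry π i < 0).card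

/-- The letter `σ_i` of `σ = σ_1 σ_2 ⋯ σ_m`, for `1 ≤ i ≤ m`, with `σ_0 = 0`
(and `0` beyond the end of the word). -/
def letter (σ : List ℕ) (i : ℕ) : ℕ := (0 :: σ).getD i 0

/-- The Stirling condition: if `σ_i = σ_j`, then `σ_s > σ_i` for all `i < s < j`. -/
def IsStirling (σ : List ℕ) : Prop :=
  ∀ i ∈ Finset.Icc 1 σ.length, ∀ j ∈ Finset.Icc 1 σ.length, letter σ i = letter σ j →
    ∀ s ∈ Finset.Ioo i j, letter σ s > letter σ i

instance : DecidablePred IsStirling := fun σ => by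
  unfold IsStirling; infer_instance

/-- The multiset `{1, 2², 3², …, m²}` (for `m ≥ 1`), in which only `1` appears once. -/
def oneSingleMultiset (m : ℕ) : Multiset ℕ := {1} + 2 • (Finset.Icc 2 m).val

/-- The Stirling permutations of the multiset `{1, 2², 3², …, m²}`, as words
(`M.lists.toFinset` is the finite set of all arrangements of the multiset `M` as lists). -/
def stirlingZero (m : ℕ) : Finset (List ℕ) :=
  (oneSingleMultiset m).lists.toFinset.filter IsStirling

/-- Left ascent-plateaux: `σ_{i-1} < σ_i = σ_{i+1}` with `1 ≤ i ≤ m - 1` and `σ_0 = 0`,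
where `m` is the length of `σ`. -/
def lap (σ : List ℕ) : ℕ :=
  ((Finset.Ico 1 σ.length).filter fun i =>
    letter σ (i - 1) < letter σ i ∧ letter σ i = letter σ (i + 1)).card

/-- Ascent-plateaux: `σ_{i-1} < σ_i = σ_{i+1}` with `2 ≤ i ≤ m - 1`,
where `m` is the length of `σ`. -/
def ap (σ : List ℕ) : ℕ :=
  ((Finset.Ico 2 σ.length).filter fun i =>
    letter σ (i - 1) < letter σ i ∧ letter σ i = letter σ (i + 1)).card

/-- The number of even values: the values `k ≥ 2` of `σ` whose first appearance is at an even
position (positions are counted from `1`, while `List.idxOf` counts from `0`). -/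
def evenCount (σ : List ℕ) : ℕ :=
  (σ.toFinset.filter fun k => 2 ≤ k ∧ Even (σ.idxOf k + 1)).card

/-! Both families grow by inserting the largest letter, and both have the same insertion recursion
for a triple of statistics `(a, t, e)`. For signed permutations, `a = desA + 1`, `t` says that the
first letter is positive, and `e = neg`. For Stirling permutations, `a = lap`, `t` says that the
word starts with a plateau, and `e = even`. Since `desB = desA + 1 - [t]` and `ap = lap - [t]`,
equidistribution of the triples gives the theorem.

In a Stirling permutation of length `2n - 1` the pair `MM` may enter any of the `2n` gaps. An even
gap leaves `e` fixed, an odd gap raises it by one. The pair always makes a new left ascent-plateau,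
and destroys an old one at `i` exactly when it enters gap `i - 1` or `i`; these two gaps have
opposite parities, so in each parity class `a` gaps keep `a` and `n - a` raise it. Gap 0 makes `t`
true and gap 1 makes it false.

In a signed word of length `n - 1`, the letters `n` and `-n` play the roles of the even and odd
gaps. For `n`, the descents and the right end keep the number of descents; for `-n`, the descents
and the left end do. So again `a` of the `n` gaps keep `a`, and `t` changes only at the left end.

Both recursions are expressed by the operator `insertionStep` on arbitrary functions `f` of the
triple (`sum_stirlingValue_succ`, `sum_signedValue_succ`); an induction on `n` over all `f`
concludes. -/

/-! ### Insertion into words -/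

/-- Insertion of the word `u` into the word `l` after its first `g` letters. -/
def insertWord {α : Type*} (g : ℕ) (u l : List α) : List α := l.take g ++ (u ++ l.drop g)

/-- The letter number `i` of a word, numbered from `1`, and `0` outside the word. -/
def entry {α : Type*} [Zero α] (l : List α) (i : ℕ) : α := (0 :: l).getD i 0

theorem letter_eq_entry (σ : List ℕ) (i : ℕ) : letter σ i = entry σ i := rfl

theorem length_insertWord {α : Type*} (g : ℕ) (u l : List α) :
    (insertWord g u l).length = l.length + u.length := by
  simp only [insertWord, List.length_append, List.length_take, List.length_drop]
  omega

theorem entry_insertWord {α : Type*} [Zero α] {g : ℕ} (u l : List α) (hg : g ≤ l.length) (i : ℕ) :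
    entry (insertWord g u l) i =
      if i ≤ g then entry l i
      else if i ≤ g + u.length then u.getD (i - g - 1) 0 else entry l (i - u.length) := by
  cases i with
  | zero => simp [entry]
  | succ i =>
    have h1 : (l.take g).length = g := by simp [hg]
    simp only [entry, insertWord, List.getD_cons_succ]
    split_ifs with h2 h3
    · rw [List.getD_append _ _ _ _ (by omega)]
      simp only [List.getD_eq_getElem?_getD]
      rw [List.getElem?_take_of_lt (by omega)]
    · rw [List.getD_append_right _ _ _ _ (by omega), List.getD_append _ _ _ _ (by omega), h1]
      congr 1
      omega
    · rw [List.getD_append_right _ _ _ _ (by omega), List.getD_append_right _ _ _ _ (by omega), h1]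
      obtain ⟨j, rfl⟩ : ∃ j, i = g + u.length + j := ⟨i - (g + u.length), by omega⟩
      rw [show g + u.length + j + 1 - u.length = (g + j) + 1 by omega, List.getD_cons_succ,
        show g + u.length + j - g - u.length = j by omega]
      simp [List.getD_eq_getElem?_getD, List.getElem?_drop]

theorem entry_mem {α : Type*} [Zero α] {l : List α} {i : ℕ} (h1 : 1 ≤ i) (h2 : i ≤ l.length) :
    entry l i ∈ l := by
  obtain ⟨i, rfl⟩ : ∃ j, i = j + 1 := ⟨i - 1, by omega⟩
  simp only [entry, List.getD_cons_succ]
  rw [List.getD_eq_getElem _ _ (by omega)]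
  exact List.getElem_mem _

theorem entry_of_length_lt {α : Type*} [Zero α] {l : List α} {i : ℕ} (h : l.length < i) :
    entry l i = 0 := by
  simp only [entry]
  exact List.getD_eq_default _ _ (by simpa using h)

theorem sum_ite_const {ι R : Type*} [AddCommMonoid R] (s : Finset ι) (P : ι → Prop)
    [DecidablePred P] (u v : R) {c : ℕ} (hc : (∑ k ∈ s, if P k then 1 else 0) = c) :
    ∑ k ∈ s, (if P k then u else v) = c • u + (s.card - c) • v := by
  rw [Finset.sum_ite, Finset.sum_const, Finset.sum_const]
  rw [Finset.sum_boole, Nat.cast_id] at hc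
  have := Finset.card_filter_add_card_filter_not (s := s) P
  rw [hc] at this ⊢
  rw [← this]
  congr 2
  omega

theorem sum_range_two_mul {R : Type*} [AddCommMonoid R] (F : ℕ → R) (n : ℕ) :
    ∑ g ∈ Finset.range (2 * n), F g =
      ∑ k ∈ Finset.range n, F (2 * k) + ∑ k ∈ Finset.range n, F (2 * k + 1) := by
  induction n with
  | zero => simp
  | succ n ih =>
    rw [Finset.sum_range_succ, Finset.sum_range_succ, Nat.mul_succ, Finset.sum_range_succ,
      Finset.sum_range_succ, ih]
    abel

/-- The effect of one insertion on a function of the statistics: a word with first statistic `a`,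
initial behaviour `t` and third statistic `e` has `2 * n` successors. -/
def insertionStep {R : Type*} [AddCommMonoid R] (n : ℕ) (f : ℕ → Bool → ℕ → R)
    (a : ℕ) (t : Bool) (e : ℕ) : R :=
  -- First summand: even gaps, or a positive new letter; second: odd gaps, or a negative one. The
  -- isolated terms, and the `a - 1` and `n - a - 1`, account for the one gap that may change `t`.
  (a • f a t e + cond t ((n - a) • f (a + 1) true e)
      (f (a + 1) true e + (n - a - 1) • f (a + 1) false e)) +
    (cond t (f a false (e + 1) + (a - 1) • f a true (e + 1)) (a • f a false (e + 1)) +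
      (n - a) • f (a + 1) t (e + 1))

/-! ### Statistics of a Stirling permutation under insertion of a pair -/

/-- A left ascent-plateau of the sequence `s` at `i`. -/
def IsLapAt (s : ℕ → ℕ) (i : ℕ) : Prop := s (i - 1) < s i ∧ s i = s (i + 1)

instance (s : ℕ → ℕ) : DecidablePred (IsLapAt s) := fun i => by
  unfold IsLapAt; infer_instance

theorem not_isLapAt_zero (s : ℕ → ℕ) : ¬ IsLapAt s 0 := fun h => lt_irrefl _ h.1

theorem not_isLapAt_succ {s : ℕ → ℕ} {i : ℕ} (h : IsLapAt s i) : ¬ IsLapAt s (i + 1) := fun h' => by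
  have h1 := h.2
  have h2 := h'.1
  simp only [Nat.add_sub_cancel] at h2
  omega

theorem not_isLapAt_of_length_le {σ : List ℕ} {i : ℕ} (hi : σ.length ≤ i) :
    ¬ IsLapAt (entry σ) i := by
  rintro ⟨h1, h2⟩
  rw [entry_of_length_lt (show σ.length < i + 1 by omega)] at h2
  omega

theorem lap_eq_sum {σ : List ℕ} {N : ℕ} (hN : σ.length ≤ N) :
    lap σ = ∑ i ∈ Finset.range N, if IsLapAt (entry σ) i then 1 else 0 := by
  rw [Finset.sum_boole, Nat.cast_id, lap]
  congr 1
  ext i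
  simp only [Finset.mem_filter, Finset.mem_Ico, Finset.mem_range]
  constructor
  · rintro ⟨h1, h2⟩
    exact ⟨by omega, h2⟩
  · rintro ⟨h1, h2⟩
    refine ⟨⟨?_, ?_⟩, h2⟩
    · rcases Nat.eq_zero_or_pos i with rfl | h
      · exact absurd h2 (not_isLapAt_zero _)
      · exact h
    · by_contra h
      exact not_isLapAt_of_length_le (by omega) h2

/-- The new pair is a left ascent-plateau at `g + 1`. It splits a plateau that began at `g`, and
removes the ascent before one that began at `g + 1`; everything further right is shifted by 2. -/
theorem sum_isLapAt_insert {s s' : ℕ → ℕ} {M g N : ℕ} (hs : ∀ i, s i < M) (hN : g + 2 ≤ N)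
    (hs' : ∀ i, s' i = if i ≤ g then s i else if i ≤ g + 2 then M else s (i - 2)) :
    (∑ i ∈ Finset.range (N + 2), if IsLapAt s' i then 1 else 0) +
        ((if IsLapAt s g then 1 else 0) + (if IsLapAt s (g + 1) then 1 else 0)) =
      (∑ i ∈ Finset.range N, if IsLapAt s i then 1 else 0) + 1 := by
  induction N, hN using Nat.le_induction with
  | base =>
    have e0 : ¬ IsLapAt s' g := by
      rintro ⟨-, h⟩
      have := hs g
      simp only [hs'] at h
      simp at h
      omega
    have e1 : IsLapAt s' (g + 1) := by
      have := hs g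
      constructor <;> simp [hs', this]
    have e2 : ¬ IsLapAt s' (g + 2) := by
      rintro ⟨h, -⟩
      simp [hs'] at h
    have e3 : ¬ IsLapAt s' (g + 3) := by
      rintro ⟨h, -⟩
      have := hs (g + 1)
      simp [hs'] at h
      omega
    have e4 : (∑ i ∈ Finset.range g, if IsLapAt s' i then 1 else 0) =
        ∑ i ∈ Finset.range g, if IsLapAt s i then 1 else 0 := by
      refine Finset.sum_congr rfl fun i hi => ?_
      rw [Finset.mem_range] at hi
      simp only [IsLapAt, hs', show i - 1 ≤ g by omega, show i ≤ g by omega,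
        show i + 1 ≤ g by omega, if_true]
    simp only [Finset.sum_range_succ, e0, e1, e2, e3, e4, if_true, if_false]
    omega
  | succ N hN ih =>
    have e : IsLapAt s' (N + 2) ↔ IsLapAt s N := by
      simp only [IsLapAt, hs']
      rw [if_neg (by omega), if_neg (by omega), if_neg (by omega), if_neg (by omega),
        if_neg (by omega), if_neg (by omega)]
      simp only [Nat.add_sub_cancel, show N + 2 - 1 - 2 = N - 1 by omega,
        show N + 2 + 1 - 2 = N + 1 by omega]
    rw [show N + 1 + 2 = (N + 2) + 1 by omega, Finset.sum_range_succ, Finset.sum_range_succ _ N,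
      if_congr e rfl rfl]
    omega

theorem entry_lt {σ : List ℕ} {M : ℕ} (hM : 0 < M) (h : ∀ k ∈ σ, k < M) (i : ℕ) :
    entry σ i < M := by
  rcases Nat.eq_zero_or_pos i with rfl | hi
  · simpa [entry] using hM
  · by_cases h2 : i ≤ σ.length
    · exact h _ (entry_mem hi h2)
    · rw [entry_of_length_lt (by omega)]
      exact hM

theorem entry_insertWord_pair {M g : ℕ} {σ : List ℕ} (hg : g ≤ σ.length) (i : ℕ) :
    entry (insertWord g [M, M] σ) i =
      if i ≤ g then entry σ i else if i ≤ g + 2 then M else entry σ (i - 2) := by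
  rw [entry_insertWord _ _ hg]
  simp only [List.length_cons, List.length_nil]
  split_ifs with h1 h2 <;> try rfl
  obtain h | h : i - g - 1 = 0 ∨ i - g - 1 = 1 := by omega
  all_goals simp [h]

theorem lap_insertWord {M g : ℕ} {σ : List ℕ} (hM : 0 < M)
    (h : ∀ k ∈ σ, k < M) (hg : g ≤ σ.length) :
    lap (insertWord g [M, M] σ) =
      if IsLapAt (entry σ) g ∨ IsLapAt (entry σ) (g + 1) then lap σ else lap σ + 1 := by
  have key := sum_isLapAt_insert (s := entry σ) (g := g) (N := σ.length + 2) (entry_lt hM h)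
    (by omega) (entry_insertWord_pair hg)
  rw [← lap_eq_sum (by simp [length_insertWord]), ← lap_eq_sum (by omega)] at key
  by_cases h1 : IsLapAt (entry σ) g
  · have h2 := not_isLapAt_succ h1
    simp only [h1, h2, if_true, if_false, true_or] at key ⊢
    omega
  · by_cases h2 : IsLapAt (entry σ) (g + 1)
    · simp only [h1, h2, if_true, if_false, or_true] at key ⊢
      omega
    · simp only [h1, h2, if_false, or_self] at key ⊢
      omega

/-- An old letter moves by 0 or 2 places, so its parity is kept. -/
theorem idxOf_insertWord_pair {M g k : ℕ} {σ : List ℕ} (hkM : k ≠ M) :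
    Even ((insertWord g [M, M] σ).idxOf k + 1) ↔ Even (σ.idxOf k + 1) := by
  have hσ : σ.idxOf k = (σ.take g ++ σ.drop g).idxOf k := by rw [List.take_append_drop]
  rw [hσ, insertWord]
  by_cases h : k ∈ σ.take g
  · rw [List.idxOf_append_of_mem h, List.idxOf_append_of_mem h]
  · rw [List.idxOf_append_of_notMem h, List.idxOf_append_of_notMem h]
    simp only [List.cons_append, List.nil_append]
    rw [List.idxOf_cons_ne _ hkM.symm, List.idxOf_cons_ne _ hkM.symm]
    simp only [Nat.succ_eq_add_one, Nat.even_iff]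
    omega

theorem idxOf_insertWord_self {M g : ℕ} {σ : List ℕ} (hM : M ∉ σ) (hg : g ≤ σ.length) :
    (insertWord g [M, M] σ).idxOf M = g := by
  rw [insertWord, List.idxOf_append_of_notMem (fun hm => hM (List.mem_of_mem_take hm))]
  simp [hg]

theorem evenCount_insertWord {M g : ℕ} {σ : List ℕ} (hM : 2 ≤ M)
    (h : ∀ k ∈ σ, k < M) (hg : g ≤ σ.length) :
    evenCount (insertWord g [M, M] σ) = if Even g then evenCount σ else evenCount σ + 1 := by
  have hMσ : M ∉ σ := fun hm => lt_irrefl _ (h M hm)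
  have hset : (insertWord g [M, M] σ).toFinset = insert M σ.toFinset := by
    ext k
    have := List.take_append_drop g σ
    rw [Finset.mem_insert, List.mem_toFinset, List.mem_toFinset]
    conv_rhs => rw [← this]
    simp only [insertWord, List.mem_append, List.mem_cons, List.not_mem_nil, or_false]
    tauto
  have hcongr : σ.toFinset.filter (fun k => 2 ≤ k ∧ Even ((insertWord g [M, M] σ).idxOf k + 1)) =
      σ.toFinset.filter (fun k => 2 ≤ k ∧ Even (σ.idxOf k + 1)) := by
    refine Finset.filter_congr fun k hk => ?_
    rw [List.mem_toFinset] at hk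
    rw [idxOf_insertWord_pair (h k hk).ne]
  rw [evenCount, hset, Finset.filter_insert, idxOf_insertWord_self hMσ hg, hcongr]
  by_cases hg2 : Even g
  · rw [if_neg, if_pos hg2, evenCount]
    rintro ⟨-, h2⟩
    rw [Nat.even_iff] at h2 hg2
    omega
  · rw [if_pos, if_neg hg2, Finset.card_insert_of_notMem, evenCount]
    · simp [hMσ]
    · refine ⟨hM, ?_⟩
      rw [Nat.even_iff] at hg2 ⊢
      omega

/-- A word starts with a plateau. -/
def startsWithPlateau (σ : List ℕ) : Bool := decide (letter σ 1 = letter σ 2)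

theorem startsWithPlateau_insertWord {M g : ℕ} {σ : List ℕ} (hM : ∀ k ∈ σ, k < M)
    (hg : g ≤ σ.length) (hσ : σ ≠ []) :
    startsWithPlateau (insertWord g [M, M] σ) =
      if g = 0 then true else if g = 1 then false else startsWithPlateau σ := by
  have h1 : entry σ 1 < M := hM _ (entry_mem le_rfl (List.length_pos_of_ne_nil hσ))
  simp only [startsWithPlateau, letter_eq_entry, entry_insertWord_pair hg]
  by_cases h2 : g = 0
  · simp [h2]
  by_cases h3 : g = 1
  · simp [h3, h1.ne]
  · simp only [h2, h3, show 1 ≤ g by omega, show 2 ≤ g by omega, if_true, if_false]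
    rfl

theorem isLapAt_one_iff {σ : List ℕ} (h0 : ∀ k ∈ σ, 1 ≤ k) (hσ : σ ≠ []) :
    IsLapAt (entry σ) 1 ↔ startsWithPlateau σ = true := by
  have h1 : 1 ≤ entry σ 1 := h0 _ (entry_mem le_rfl (List.length_pos_of_ne_nil hσ))
  rw [startsWithPlateau, decide_eq_true_eq]
  exact ⟨fun h => h.2, fun h => ⟨h1, h⟩⟩

/-- The pairs `{2k, 2k + 1}` partition the positions, and at most one position of each pair is a
left ascent-plateau. Hence exactly `lap σ` even gaps preserve `lap`. -/
theorem sum_isLapAt_even {σ : List ℕ} {n : ℕ} (hn : σ.length ≤ 2 * n) :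
    (∑ k ∈ Finset.range n,
      if IsLapAt (entry σ) (2 * k) ∨ IsLapAt (entry σ) (2 * k + 1) then 1 else 0) = lap σ := by
  rw [lap_eq_sum hn, sum_range_two_mul, ← Finset.sum_add_distrib]
  refine Finset.sum_congr rfl fun k _ => ?_
  have := not_isLapAt_succ (s := entry σ) (i := 2 * k)
  by_cases h1 : IsLapAt (entry σ) (2 * k) <;> by_cases h2 : IsLapAt (entry σ) (2 * k + 1) <;>
    simp_all

theorem sum_isLapAt_odd {σ : List ℕ} {n : ℕ} (hn : σ.length ≤ 2 * n) :
    (∑ k ∈ Finset.range n,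
      if IsLapAt (entry σ) (2 * k + 1) ∨ IsLapAt (entry σ) (2 * k + 1 + 1) then 1 else 0) =
        lap σ := by
  -- The pairs `{2k + 1, 2k + 2}` miss position 0, which is never a left ascent-plateau.
  rw [lap_eq_sum (show σ.length ≤ 2 * n + 1 by omega), Finset.sum_range_succ',
    if_neg (not_isLapAt_zero _), add_zero, sum_range_two_mul, ← Finset.sum_add_distrib]
  refine Finset.sum_congr rfl fun k _ => ?_
  have := not_isLapAt_succ (s := entry σ) (i := 2 * k + 1)
  by_cases h1 : IsLapAt (entry σ) (2 * k + 1) <;>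
    by_cases h2 : IsLapAt (entry σ) (2 * k + 1 + 1) <;> simp_all

/-- The value of `f` at the statistics of a Stirling permutation. -/
def stirlingValue {R : Type*} (f : ℕ → Bool → ℕ → R) (σ : List ℕ) : R :=
  f (lap σ) (startsWithPlateau σ) (evenCount σ)

theorem sum_stirlingValue_insertWord {R : Type*} [AddCommMonoid R] (f : ℕ → Bool → ℕ → R)
    {M n : ℕ} {σ : List ℕ} (hM : 2 ≤ M) (h0 : ∀ k ∈ σ, 1 ≤ k) (h : ∀ k ∈ σ, k < M)
    (hn : σ.length + 1 = 2 * n) (hσ : σ ≠ []) :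
    ∑ g ∈ Finset.range (2 * n), stirlingValue f (insertWord g [M, M] σ) =
      insertionStep n f (lap σ) (startsWithPlateau σ) (evenCount σ) := by
  have hval : ∀ g < 2 * n, stirlingValue f (insertWord g [M, M] σ) =
      if IsLapAt (entry σ) g ∨ IsLapAt (entry σ) (g + 1) then
        f (lap σ) (if g = 0 then true else if g = 1 then false else startsWithPlateau σ)
          (if Even g then evenCount σ else evenCount σ + 1)
      else f (lap σ + 1) (if g = 0 then true else if g = 1 then false else startsWithPlateau σ)
          (if Even g then evenCount σ else evenCount σ + 1) := fun g hg => by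
    rw [stirlingValue, lap_insertWord (by omega) h (by omega),
      startsWithPlateau_insertWord h (by omega) hσ, evenCount_insertWord hM h (by omega)]
    split_ifs <;> rfl
  have hpos := isLapAt_one_iff h0 hσ
  obtain ⟨n, rfl⟩ : ∃ m, n = m + 1 := ⟨n - 1, by omega⟩
  have hE := sum_isLapAt_even (σ := σ) (n := n + 1) (by omega)
  have hO := sum_isLapAt_odd (σ := σ) (n := n + 1) (by omega)
  rw [sum_range_two_mul, insertionStep]
  generalize lap σ = a at *
  generalize evenCount σ = e at *
  have not2 : ∀ k, ¬ 2 * k + 1 = 0 := fun k => by omega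
  have ev : ∀ k, Even (2 * k) := fun k => even_two_mul k
  have od : ∀ k, ¬ Even (2 * k + 1) := fun k => by rw [Nat.even_iff]; omega
  congr 1
  · rw [Finset.sum_congr rfl fun k hk => hval (2 * k) (by rw [Finset.mem_range] at hk; omega)]
    simp only [ev, if_true]
    cases ht : startsWithPlateau σ
    -- Gap 0 raises `lap` and makes `t` true; all `a` preserving even gaps are among the others.
    · have h1 : ¬ IsLapAt (entry σ) 1 := by rw [hpos, ht]; simp
      rw [Finset.sum_range_succ'] at hE ⊢
      simp only [mul_zero, zero_add, not_isLapAt_zero, h1, or_self, if_false, add_zero] at hE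
      simp only [mul_zero, zero_add, not_isLapAt_zero, h1, or_self, if_false, if_true,
        show ∀ k, ¬ 2 * (k + 1) = 0 from fun k => by omega,
        show ∀ k, ¬ 2 * (k + 1) = 1 from fun k => by omega, cond_false]
      rw [sum_ite_const _ _ _ _ hE, Finset.card_range, show n + 1 - a - 1 = n - a by omega]
      abel
    · have hb : ∀ k, (if 2 * k = 0 then true else if 2 * k = 1 then false else true) = true :=
        fun k => by split_ifs <;> first | rfl | omega
      simp only [hb]
      rw [sum_ite_const _ _ _ _ hE, Finset.card_range, cond_true]
  · rw [Finset.sum_congr rfl fun k hk => hval (2 * k + 1) (by rw [Finset.mem_range] at hk; omega)]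
    simp only [od, not2, if_false]
    cases ht : startsWithPlateau σ
    · simp only [ite_self]
      rw [sum_ite_const _ _ _ _ hO, Finset.card_range, cond_false]
    -- Gap 1 splits the initial plateau: it is one of the `a` preserving odd gaps and the only one
    -- that makes `t` false, leaving `a - 1`.
    · have h1 : IsLapAt (entry σ) 1 := by rw [hpos, ht]
      rw [Finset.sum_range_succ'] at hO ⊢
      simp only [mul_zero, zero_add, h1, true_or, if_true] at hO
      have hO' : (∑ k ∈ Finset.range n, if IsLapAt (entry σ) (2 * (k + 1) + 1) ∨
          IsLapAt (entry σ) (2 * (k + 1) + 1 + 1) then 1 else 0) = a - 1 := by omega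
      simp only [mul_zero, zero_add, h1, true_or, if_true,
        show ∀ k, ¬ 2 * (k + 1) + 1 = 1 from fun k => by omega, if_false, cond_true]
      rw [sum_ite_const _ _ _ _ hO', Finset.card_range, show n - (a - 1) = n + 1 - a by omega]
      abel

/-! ### Generating Stirling permutations by insertion of the largest pair -/

/-- Pattern form of the condition: it visibly passes to sublists, so deleting letters is harmless.
-/
theorem isStirling_iff (σ : List ℕ) : IsStirling σ ↔ ∀ a b, [a, b, a].Sublist σ → a < b := by
  constructor
  · intro h a b hs
    obtain ⟨f, hf⟩ := List.sublist_iff_exists_orderEmbedding_getElem?_eq.1 hs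
    have h0 := hf 0
    have h1 := hf 1
    have h2 := hf 2
    simp only [List.getElem?_cons_zero, List.getElem?_cons_succ] at h0 h1 h2
    have l0 : f 0 < f 1 := f.strictMono (by omega)
    have l1 : f 1 < f 2 := f.strictMono (by omega)
    have hl : f 2 < σ.length := by
      by_contra hl
      rw [List.getElem?_eq_none (by omega)] at h2
      simp at h2
    have := h (f 0 + 1) (by rw [Finset.mem_Icc]; omega) (f 2 + 1) (by rw [Finset.mem_Icc]; omega)
      (by simp [letter, List.getD_eq_getElem?_getD, ← h0, ← h2])
      (f 1 + 1) (by rw [Finset.mem_Ioo]; omega)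
    simpa [letter, List.getD_eq_getElem?_getD, ← h0, ← h1] using this
  · intro h i hi j hj hij s hs
    rw [Finset.mem_Icc] at hi hj
    rw [Finset.mem_Ioo] at hs
    obtain ⟨i, rfl⟩ : ∃ k, i = k + 1 := ⟨i - 1, by omega⟩
    obtain ⟨j, rfl⟩ : ∃ k, j = k + 1 := ⟨j - 1, by omega⟩
    obtain ⟨s, rfl⟩ : ∃ k, s = k + 1 := ⟨s - 1, by omega⟩
    have hi' : i < σ.length := by omega
    have hj' : j < σ.length := by omega
    have hs' : s < σ.length := by omega
    simp only [letter, List.getD_cons_succ, List.getD_eq_getElem _ _ hi',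
      List.getD_eq_getElem _ _ hj', List.getD_eq_getElem _ _ hs'] at hij ⊢
    refine h _ _ ?_
    have := List.map_getElem_sublist (l := σ) (is := [⟨i, hi'⟩, ⟨s, hs'⟩, ⟨j, hj'⟩])
      (by simp; omega)
    simpa [hij] using this

theorem oneSingleMultiset_succ {m : ℕ} (hm : 1 ≤ m) :
    oneSingleMultiset (m + 1) = oneSingleMultiset m + {m + 1, m + 1} := by
  have : Finset.Icc 2 (m + 1) = insert (m + 1) (Finset.Icc 2 m) := by
    ext k
    simp only [Finset.mem_Icc, Finset.mem_insert]
    omega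
  rw [oneSingleMultiset, oneSingleMultiset, this, Finset.insert_val_of_notMem (by simp), two_nsmul,
    two_nsmul, ← Multiset.singleton_add, Multiset.insert_eq_cons, ← Multiset.singleton_add]
  abel

theorem mem_stirlingZero {m : ℕ} {σ : List ℕ} :
    σ ∈ stirlingZero m ↔ oneSingleMultiset m = (σ : Multiset ℕ) ∧ IsStirling σ := by
  rw [stirlingZero, Finset.mem_filter, Multiset.mem_toFinset, Multiset.mem_lists_iff]
  rfl

theorem mem_oneSingleMultiset {m k : ℕ} (hm : 1 ≤ m) (hk : k ∈ oneSingleMultiset m) :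
    1 ≤ k ∧ k ≤ m := by
  simp only [oneSingleMultiset, Multiset.mem_add, Multiset.mem_singleton,
    Multiset.mem_nsmul, Finset.mem_val, Finset.mem_Icc] at hk
  omega

theorem card_oneSingleMultiset {m : ℕ} (hm : 1 ≤ m) :
    (oneSingleMultiset m).card + 1 = 2 * m := by
  simp [oneSingleMultiset]
  omega

theorem filter_insertWord_pair {M g : ℕ} {σ : List ℕ} (hM : M ∉ σ) :
    (insertWord g [M, M] σ).filter (· ≠ M) = σ := by
  rw [insertWord, List.filter_append, List.filter_append]
  simp only [ne_eq, not_true_eq_false, decide_false, Bool.false_eq_true, not_false_eq_true,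
    List.filter_cons_of_neg, List.filter_nil, List.nil_append]
  rw [← List.filter_append, List.take_append_drop, List.filter_eq_self]
  intro k hk
  simpa using ne_of_mem_of_not_mem hk hM

theorem insertWord_pair_isStirling {M g : ℕ} {σ : List ℕ} (h : ∀ k ∈ σ, k < M)
    (hs : IsStirling σ) : IsStirling (insertWord g [M, M] σ) := by
  have hM : M ∉ σ := fun hm => lt_irrefl _ (h M hm)
  rw [isStirling_iff] at hs ⊢
  intro a b hab
  have hmem : ∀ k ∈ insertWord g [M, M] σ, k = M ∨ k ∈ σ := by
    intro k hk
    simp only [insertWord, List.mem_append, List.mem_cons, List.not_mem_nil, or_false] at hk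
    rcases hk with hk | hk | hk
    · exact Or.inr (List.mem_of_mem_take hk)
    · exact Or.inl (by tauto)
    · exact Or.inr (List.mem_of_mem_drop hk)
  have ha := hmem a (hab.subset (by simp))
  have hb := hmem b (hab.subset (by simp))
  have hcount : (insertWord g [M, M] σ).count M = 2 := by
    simp [insertWord, List.count_eq_zero_of_not_mem (fun hm => hM (List.mem_of_mem_take hm)),
      List.count_eq_zero_of_not_mem (fun hm => hM (List.mem_of_mem_drop hm))]
  -- A pattern `M b M` would need a third `M` if `b = M`, and otherwise a letter between the two
  -- adjacent copies.
  have haM : a ≠ M := by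
    rintro rfl
    by_cases hba : b = a
    · subst hba
      have := hab.count_le b
      simp [hcount] at this
    · rw [insertWord, List.sublist_append_iff] at hab
      obtain ⟨l₁, l₂, he, h1, h2⟩ := hab
      cases l₁ with
      | cons c l₁ =>
        simp only [List.cons_append, List.cons.injEq] at he
        exact hM (List.mem_of_mem_take (h1.subset (by simp [he.1])))
      | nil =>
        rw [List.nil_append] at he
        rw [← he] at h2
        simp only [List.cons_append, List.nil_append, List.cons_sublist_cons] at h2
        rw [List.sublist_cons_iff] at h2
        rcases h2 with h2 | ⟨r, hr, -⟩
        · exact hM (List.mem_of_mem_drop (h2.subset (by simp)))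
        · simp only [List.cons.injEq] at hr
          exact hba hr.1
  by_cases hbM : b = M
  · have := h a (by tauto)
    omega
  · refine hs a b ?_
    -- Deleting the copies of `M` turns the pattern into one of `σ`.
    have := hab.filter (· ≠ M)
    rw [filter_insertWord_pair hM] at this
    simpa [haM, hbM] using this

/-- A letter between the two copies of the maximum would have to exceed it, so the copies are
adjacent. -/
theorem exists_eq_append_pair {M : ℕ} {τ : List ℕ} (hM : ∀ k ∈ τ, k ≤ M) (hc : τ.count M = 2)
    (hs : IsStirling τ) : ∃ l₁ l₂ : List ℕ, τ = l₁ ++ ([M, M] ++ l₂) ∧ M ∉ l₁ ∧ M ∉ l₂ := by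
  rw [isStirling_iff] at hs
  obtain ⟨l₁, l, rfl, h1⟩ :=
    List.eq_append_cons_of_mem (List.count_pos_iff.1 (by omega : 0 < τ.count M))
  rw [List.count_append, List.count_eq_zero_of_not_mem h1, List.count_cons_self] at hc
  cases l with
  | nil => simp at hc
  | cons b l =>
    by_cases hb : b = M
    · subst hb
      rw [List.count_cons_self] at hc
      exact ⟨l₁, l, rfl, h1, List.count_eq_zero.1 (by omega)⟩
    · rw [List.count_cons_of_ne hb] at hc
      have hl : M ∈ l := List.count_pos_iff.1 (by omega)
      have := hs M b (List.Sublist.trans (by simpa using hl) (List.sublist_append_right l₁ _))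
      have := hM b (by simp)
      omega

theorem insertWord_length_append {α : Type*} (l₁ u l₂ : List α) :
    insertWord l₁.length u (l₁ ++ l₂) = l₁ ++ (u ++ l₂) := by
  simp [insertWord]

theorem insertWord_perm {α : Type*} (g : ℕ) (u l : List α) :
    (insertWord g u l).Perm (l ++ u) := by
  rw [insertWord]
  conv_rhs => rw [← List.take_append_drop g l, List.append_assoc]
  exact List.Perm.append_left _ List.perm_append_comm

theorem coe_insertWord_pair (M g : ℕ) (σ : List ℕ) :
    (insertWord g [M, M] σ : Multiset ℕ) = (σ : Multiset ℕ) + {M, M} := by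
  rw [Multiset.coe_eq_coe.2 (insertWord_perm _ _ _), ← Multiset.coe_add]
  rfl

theorem lt_of_mem_stirlingZero {m : ℕ} (hm : 1 ≤ m) {σ : List ℕ} (hσ : σ ∈ stirlingZero m)
    {k : ℕ} (hk : k ∈ σ) : 1 ≤ k ∧ k < m + 1 := by
  rw [mem_stirlingZero] at hσ
  have := mem_oneSingleMultiset (k := k) hm (by rw [hσ.1]; simpa using hk)
  omega

theorem length_of_mem_stirlingZero {m : ℕ} (hm : 1 ≤ m) {σ : List ℕ} (hσ : σ ∈ stirlingZero m) :
    σ.length + 1 = 2 * m := by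
  rw [mem_stirlingZero] at hσ
  rw [← card_oneSingleMultiset hm, hσ.1, Multiset.coe_card]

theorem insertWord_mem_stirlingZero {m g : ℕ} (hm : 1 ≤ m) {σ : List ℕ} (hσ : σ ∈ stirlingZero m) :
    insertWord g [m + 1, m + 1] σ ∈ stirlingZero (m + 1) := by
  refine mem_stirlingZero.2 ⟨?_, insertWord_pair_isStirling
    (fun k hk => (lt_of_mem_stirlingZero hm hσ hk).2) (mem_stirlingZero.1 hσ).2⟩
  rw [coe_insertWord_pair, oneSingleMultiset_succ hm, (mem_stirlingZero.1 hσ).1]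

theorem exists_eq_insertWord_of_mem_stirlingZero {m : ℕ} (hm : 1 ≤ m) {τ : List ℕ}
    (hτ : τ ∈ stirlingZero (m + 1)) :
    ∃ σ ∈ stirlingZero m, ∃ g < 2 * m, τ = insertWord g [m + 1, m + 1] σ := by
  have hle : ∀ k ∈ τ, k ≤ m + 1 := fun k hk => by
    have := lt_of_mem_stirlingZero (by omega) hτ hk
    omega
  have hlen := length_of_mem_stirlingZero (by omega) hτ
  rw [mem_stirlingZero] at hτ
  have hc : τ.count (m + 1) = 2 := by
    rw [← Multiset.coe_count, ← hτ.1, oneSingleMultiset_succ hm, Multiset.count_add,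
      Multiset.count_eq_zero_of_notMem fun hk => by have := mem_oneSingleMultiset hm hk; omega]
    simp
  obtain ⟨l₁, l₂, rfl, -, -⟩ := exists_eq_append_pair hle hc hτ.2
  refine ⟨l₁ ++ l₂, mem_stirlingZero.2 ⟨?_, ?_⟩, l₁.length, ?_, ?_⟩
  · have := hτ.1
    rw [← insertWord_length_append, coe_insertWord_pair, oneSingleMultiset_succ hm] at this
    exact add_right_cancel this
  · have := hτ.2
    rw [isStirling_iff] at this ⊢
    intro a b hab
    exact this a b (hab.trans (List.Sublist.append_left (List.sublist_append_right _ _) _))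
  · simp at hlen
    omega
  · rw [insertWord_length_append]

/-- Deleting the largest letter recovers `σ`, and its first position recovers the gap. -/
theorem sum_stirlingZero_succ {R : Type*} [AddCommMonoid R] (F : List ℕ → R) {m : ℕ}
    (hm : 1 ≤ m) :
    ∑ τ ∈ stirlingZero (m + 1), F τ =
      ∑ σ ∈ stirlingZero m, ∑ g ∈ Finset.range (2 * m),
        F (insertWord g [m + 1, m + 1] σ) := by
  rw [← Finset.sum_product']
  symm
  refine Finset.sum_bij (fun p _ => insertWord p.2 [m + 1, m + 1] p.1) ?_ ?_ ?_ (fun _ _ => rfl)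
  · rintro ⟨σ, g⟩ hp
    exact insertWord_mem_stirlingZero hm (Finset.mem_product.1 hp).1
  · rintro ⟨σ, g⟩ hp ⟨σ', g'⟩ hp' he
    simp only [Finset.mem_product, Finset.mem_range] at hp hp' he
    have hn : m + 1 ∉ σ := fun hk => lt_irrefl _ (lt_of_mem_stirlingZero hm hp.1 hk).2
    have hn' : m + 1 ∉ σ' := fun hk => lt_irrefl _ (lt_of_mem_stirlingZero hm hp'.1 hk).2
    have hl := length_of_mem_stirlingZero hm hp.1
    have hl' := length_of_mem_stirlingZero hm hp'.1
    ext1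
    · rw [← filter_insertWord_pair (g := g) hn, he, filter_insertWord_pair hn']
    · rw [← idxOf_insertWord_self (g := g) hn (by omega), he,
        idxOf_insertWord_self hn' (by omega)]
  · intro τ hτ
    obtain ⟨σ, hσ, g, hg, rfl⟩ := exists_eq_insertWord_of_mem_stirlingZero hm hτ
    exact ⟨(σ, g), Finset.mem_product.2 ⟨hσ, Finset.mem_range.2 hg⟩, rfl⟩

theorem sum_stirlingValue_succ {R : Type*} [AddCommMonoid R] (f : ℕ → Bool → ℕ → R) {m : ℕ}
    (hm : 1 ≤ m) :
    ∑ τ ∈ stirlingZero (m + 1), stirlingValue f τ =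
      ∑ σ ∈ stirlingZero m, stirlingValue (insertionStep m f) σ := by
  rw [sum_stirlingZero_succ _ hm]
  refine Finset.sum_congr rfl fun σ hσ => ?_
  have hlen := length_of_mem_stirlingZero hm hσ
  refine sum_stirlingValue_insertWord f (by omega)
    (fun k hk => (lt_of_mem_stirlingZero hm hσ hk).1)
    (fun k hk => (lt_of_mem_stirlingZero hm hσ hk).2) hlen ?_
  rintro rfl
  simp at hlen
  omega

theorem sum_stirlingValue_two {R : Type*} [AddCommMonoid R] (f : ℕ → Bool → ℕ → R) :
    ∑ τ ∈ stirlingZero 2, stirlingValue f τ = f 1 true 0 + f 1 false 1 := by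
  have h1 : stirlingZero 1 = {[1]} := by
    ext σ
    rw [mem_stirlingZero, Finset.mem_singleton]
    have : oneSingleMultiset 1 = {1} := by simp [oneSingleMultiset]
    rw [this, eq_comm (a := ({1} : Multiset ℕ)), Multiset.coe_eq_singleton]
    refine ⟨fun h => h.1, fun h => ⟨h, ?_⟩⟩
    subst h
    decide
  rw [sum_stirlingZero_succ _ le_rfl, h1, Finset.sum_singleton, Finset.sum_range_succ,
    Finset.sum_range_one]
  rfl

/-! ### Signed permutations as words, and their generation by insertion -/

/-- The one-line word `π(1) ⋯ π(n)` of a signed permutation. -/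
def signedWord {n : ℕ} (π : Equiv.Perm (PlusMinus n)) : List ℤ :=
  List.ofFn fun i : Fin n => signedEntry π (i + 1)

/-- The one-line words of the signed permutations of `±[n]`. -/
noncomputable def signedWords (n : ℕ) : Finset (List ℤ) := (signedPermutations n).image signedWord

theorem length_signedWord {n : ℕ} (π : Equiv.Perm (PlusMinus n)) : (signedWord π).length = n := by
  simp [signedWord]

theorem entry_signedWord {n : ℕ} (π : Equiv.Perm (PlusMinus n)) (i : ℕ) :
    entry (signedWord π) i = signedEntry π i := by
  cases i with
  | zero => simp [entry, signedEntry]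
  | succ i =>
    by_cases hi : i < n
    · simp [entry, signedWord, List.getD_eq_getElem?_getD, hi]
    · rw [entry_of_length_lt (by rw [length_signedWord]; omega), signedEntry, dif_neg (by omega)]

theorem PlusMinus.mem_iff {n : ℕ} {k : ℤ} :
    k ∈ (Finset.Icc (-n : ℤ) n).erase 0 ↔ 1 ≤ k.natAbs ∧ k.natAbs ≤ n := by
  simp only [Finset.mem_erase, Finset.mem_Icc]
  omega

theorem signedEntry_eq {n : ℕ} (π : Equiv.Perm (PlusMinus n)) (k : PlusMinus n) (hk : 0 < k.1) :
    signedEntry π k.1.natAbs = (π k).1 := by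
  have h := PlusMinus.mem_iff.1 k.2
  rw [signedEntry, dif_pos h]
  congr 2
  ext
  simp only
  omega

/-- The values at positive arguments determine the others by oddness. -/
theorem signedWord_injOn (n : ℕ) :
    Set.InjOn (signedWord (n := n)) (signedPermutations n) := by
  intro π hπ ρ hρ h
  simp only [signedPermutations, Finset.coe_filter, Finset.mem_univ, true_and,
    Set.mem_ofPred_eq] at hπ hρ
  have key : ∀ k : PlusMinus n, 0 < k.1 → π k = ρ k := fun k hk => by
    ext
    rw [← signedEntry_eq π k hk, ← signedEntry_eq ρ k hk, ← entry_signedWord, h, entry_signedWord]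
  ext k : 1
  have hk := PlusMinus.mem_iff.1 k.2
  rcases lt_or_gt_of_ne (show k.1 ≠ 0 by omega) with h0 | h0
  · have hb := key k.bar (by simp only [PlusMinus.bar]; omega)
    rw [hπ, hρ] at hb
    ext
    have := congrArg Subtype.val hb
    simp only [PlusMinus.bar] at this
    omega
  · exact key k h0

theorem mem_signedWords {n : ℕ} {w : List ℤ} :
    w ∈ signedWords n ↔ (w.map Int.natAbs).Perm (List.range' 1 n) := by
  have hnd : (List.range' 1 n).Nodup := List.nodup_range'
  rw [signedWords, Finset.mem_image]
  constructor
  · rintro ⟨π, hπ, rfl⟩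
    simp only [signedPermutations, Finset.mem_filter, Finset.mem_univ, true_and] at hπ
    have hnd2 : ((signedWord π).map Int.natAbs).Nodup := by
      rw [signedWord, List.map_ofFn, List.nodup_ofFn]
      intro i j hij
      let a : PlusMinus n := ⟨((i + 1 : ℕ) : ℤ), PlusMinus.mem_iff.2 (by omega)⟩
      let b : PlusMinus n := ⟨((j + 1 : ℕ) : ℤ), PlusMinus.mem_iff.2 (by omega)⟩
      have ha : signedEntry π (i + 1) = (π a).1 := by
        rw [← signedEntry_eq π a (by simp only [a]; omega)]; rfl
      have hb : signedEntry π (j + 1) = (π b).1 := by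
        rw [← signedEntry_eq π b (by simp only [b]; omega)]; rfl
      simp only [Function.comp_apply, ha, hb, Int.natAbs_eq_natAbs_iff] at hij
      rcases hij with hij | hij
      · have := congrArg Subtype.val (π.injective (Subtype.ext hij))
        simp only [a, b] at this
        ext
        omega
      -- Opposite values would force `a = -b`, impossible for positive `a` and `b`.
      · have : π a = π b.bar := by
          rw [hπ]
          exact Subtype.ext hij
        have := congrArg Subtype.val (π.injective this)
        simp only [a, b, PlusMinus.bar] at this
        omega
    refine (List.Nodup.subperm hnd2 ?_).perm_of_length_le (by simp [length_signedWord])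
    intro k hk
    rw [List.mem_map] at hk
    obtain ⟨z, hz, rfl⟩ := hk
    rw [signedWord, List.mem_ofFn] at hz
    obtain ⟨i, rfl⟩ := hz
    rw [List.mem_range'_1, signedEntry, dif_pos (by omega)]
    have := PlusMinus.mem_iff.1 (π ⟨((i + 1 : ℕ) : ℤ), PlusMinus.mem_iff.2 (by omega)⟩).2
    omega
  · intro h
    have hlen : w.length = n := by simpa using h.length_eq
    have hent : ∀ i, 1 ≤ i → i ≤ n → 1 ≤ (entry w i).natAbs ∧ (entry w i).natAbs ≤ n := by
      intro i h1 h2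
      have := h.subset (List.mem_map_of_mem (f := Int.natAbs)
        (entry_mem (l := w) h1 (by omega)))
      rw [List.mem_range'_1] at this
      omega
    have hinj : ∀ i j, 1 ≤ i → i ≤ n → 1 ≤ j → j ≤ n →
        (entry w i).natAbs = (entry w j).natAbs → i = j := by
      intro i j hi hi' hj hj' hij
      have hnd2 : (w.map Int.natAbs).Nodup := h.nodup_iff.2 hnd
      obtain ⟨i, rfl⟩ : ∃ k, i = k + 1 := ⟨i - 1, by omega⟩
      obtain ⟨j, rfl⟩ : ∃ k, j = k + 1 := ⟨j - 1, by omega⟩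
      have := (hnd2.getElem_inj_iff (i := i) (j := j) (hi := by simp; omega)
        (hj := by simp; omega)).1 (by
          simpa [entry, List.getD_eq_getElem?_getD, show i < w.length by omega,
            show j < w.length by omega] using hij)
      omega
    -- The odd extension of the word to negative arguments.
    let φ : PlusMinus n → PlusMinus n := fun k =>
      ⟨k.1.sign * entry w k.1.natAbs, by
        have hk := PlusMinus.mem_iff.1 k.2
        rw [PlusMinus.mem_iff, Int.natAbs_mul, Int.natAbs_sign_of_ne_zero (by omega), one_mul]
        exact hent _ hk.1 hk.2⟩
    have hφ : Function.Injective φ := by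
      intro a b hab
      have ha := PlusMinus.mem_iff.1 a.2
      have hb := PlusMinus.mem_iff.1 b.2
      have hab := congrArg Subtype.val hab
      simp only [φ] at hab
      have h1 : a.1.natAbs = b.1.natAbs := by
        refine hinj _ _ ha.1 ha.2 hb.1 hb.2 ?_
        have := congrArg Int.natAbs hab
        rwa [Int.natAbs_mul, Int.natAbs_mul, Int.natAbs_sign_of_ne_zero (by omega),
          Int.natAbs_sign_of_ne_zero (by omega), one_mul, one_mul] at this
      have h2 := hent _ hb.1 hb.2
      rw [h1] at hab
      have h3 : a.1.sign = b.1.sign := mul_right_cancel₀ (by omega) hab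
      ext
      rw [← Int.sign_mul_natAbs a.1, ← Int.sign_mul_natAbs b.1, h1, h3]
    refine ⟨Equiv.ofBijective φ (Finite.injective_iff_bijective.1 hφ), ?_, ?_⟩
    · simp only [signedPermutations, Finset.mem_filter, Finset.mem_univ, true_and]
      intro i
      ext
      simp [φ, PlusMinus.bar]
    · refine List.ext_getElem (by rw [length_signedWord, hlen]) fun i h1 h2 => ?_
      simp only [signedWord, List.getElem_ofFn]
      rw [signedEntry, dif_pos (by omega)]
      have h3 : ((i + 1 : ℕ) : ℤ).natAbs = i + 1 := rfl
      simp only [φ, Equiv.ofBijective_apply, h3, entry, List.getD_cons_succ,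
        List.getD_eq_getElem _ _ h2]
      rw [Int.sign_eq_one_of_pos (by omega), one_mul]

theorem insertWord_mem_signedWords {n g : ℕ} {w : List ℤ} {z : ℤ} (hw : w ∈ signedWords n)
    (hz : z.natAbs = n + 1) : insertWord g [z] w ∈ signedWords (n + 1) := by
  rw [mem_signedWords] at hw ⊢
  refine ((insertWord_perm g [z] w).map Int.natAbs).trans ?_
  rw [List.map_append, List.range'_concat]
  simp only [List.map_cons, List.map_nil, hz, one_mul, add_comm 1 n]
  exact hw.append_right _

theorem exists_eq_insertWord_of_mem_signedWords {n : ℕ} {v : List ℤ}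
    (hv : v ∈ signedWords (n + 1)) :
    ∃ w ∈ signedWords n, ∃ g < n + 1, ∃ z : ℤ, z.natAbs = n + 1 ∧ v = insertWord g [z] w := by
  rw [mem_signedWords] at hv
  have hlen : v.length = n + 1 := by simpa using hv.length_eq
  have : n + 1 ∈ v.map Int.natAbs := hv.symm.subset (by rw [List.mem_range'_1]; omega)
  obtain ⟨z, hz, hzn⟩ := List.mem_map.1 this
  obtain ⟨l₁, l₂, rfl⟩ := List.append_of_mem hz
  have he : l₁ ++ z :: l₂ = insertWord l₁.length [z] (l₁ ++ l₂) := by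
    rw [insertWord_length_append]
    rfl
  refine ⟨l₁ ++ l₂, ?_, l₁.length, ?_, z, hzn, he⟩
  · rw [mem_signedWords]
    rw [he] at hv
    have h2 := ((insertWord_perm l₁.length [z] (l₁ ++ l₂)).map Int.natAbs).symm.trans hv
    rw [List.map_append, List.range'_concat] at h2
    simp only [List.map_cons, List.map_nil, hzn, one_mul, add_comm 1 n] at h2
    exact (List.perm_append_right_iff _).1 h2
  · simp at hlen
    omega

theorem length_of_mem_signedWords {n : ℕ} {w : List ℤ} (hw : w ∈ signedWords n) :
    w.length = n := by
  rw [mem_signedWords] at hw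
  simpa using hw.length_eq

theorem natAbs_of_mem_signedWords {n : ℕ} {w : List ℤ} (hw : w ∈ signedWords n) {z : ℤ}
    (hz : z ∈ w) : 1 ≤ z.natAbs ∧ z.natAbs ≤ n := by
  rw [mem_signedWords] at hw
  have := hw.subset (List.mem_map_of_mem (f := Int.natAbs) hz)
  rw [List.mem_range'_1] at this
  omega

theorem insertWord_singleton_inj {α : Type*} [DecidableEq α] {g g' : ℕ} {w w' : List α} {z : α}
    (hw : z ∉ w) (hw' : z ∉ w') (hg : g ≤ w.length) (hg' : g' ≤ w'.length)
    (h : insertWord g [z] w = insertWord g' [z] w') : w = w' ∧ g = g' := by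
  have he : ∀ {g : ℕ} {w : List α}, z ∉ w → (insertWord g [z] w).erase z = w := fun {g w} hw => by
    rw [insertWord, List.erase_append_right _ fun hm => hw (List.mem_of_mem_take hm)]
    simp
  have hi : ∀ {g : ℕ} {w : List α}, z ∉ w → g ≤ w.length → (insertWord g [z] w).idxOf z = g :=
    fun {g w} hw hg => by
      rw [insertWord, List.idxOf_append_of_notMem fun hm => hw (List.mem_of_mem_take hm)]
      simp [hg]
  constructor
  · rw [← he (g := g) hw, h, he hw']
  · rw [← hi hw hg, h, hi hw' hg']

theorem sum_signedWords_succ {R : Type*} [AddCommMonoid R] (F : List ℤ → R) (n : ℕ) :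
    ∑ v ∈ signedWords (n + 1), F v =
      ∑ w ∈ signedWords n, (∑ g ∈ Finset.range (n + 1), F (insertWord g [(n + 1 : ℤ)] w) +
        ∑ g ∈ Finset.range (n + 1), F (insertWord g [-(n + 1 : ℤ)] w)) := by
  have hne : (n + 1 : ℤ) ≠ -(n + 1 : ℤ) := by omega
  have hpair : ∀ w : List ℤ, ∑ g ∈ Finset.range (n + 1), F (insertWord g [(n + 1 : ℤ)] w) +
      ∑ g ∈ Finset.range (n + 1), F (insertWord g [-(n + 1 : ℤ)] w) =
      ∑ z ∈ ({(n + 1 : ℤ), -(n + 1 : ℤ)} : Finset ℤ), ∑ g ∈ Finset.range (n + 1),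
        F (insertWord g [z] w) := fun w =>
    (Finset.sum_pair (f := fun z => ∑ g ∈ Finset.range (n + 1), F (insertWord g [z] w)) hne).symm
  simp only [hpair, ← Finset.sum_product']
  symm
  have hz : ∀ z : ℤ, z ∈ ({(n + 1 : ℤ), -(n + 1 : ℤ)} : Finset ℤ) ↔ z.natAbs = n + 1 := fun z => by
    rw [Finset.mem_insert, Finset.mem_singleton]
    omega
  refine Finset.sum_bij (fun p _ => insertWord p.2.2 [p.2.1] p.1) ?_ ?_ ?_ (fun _ _ => rfl)
  · rintro ⟨w, z, g⟩ hp
    simp only [Finset.mem_product, hz] at hp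
    exact insertWord_mem_signedWords hp.1 hp.2.1
  · rintro ⟨w, z, g⟩ hp ⟨w', z', g'⟩ hp' he
    simp only [Finset.mem_product, hz, Finset.mem_range] at hp hp' he
    have hn : ∀ {w : List ℤ}, w ∈ signedWords n → ∀ {z : ℤ}, z.natAbs = n + 1 → z ∉ w :=
      fun hw z hz hk => by have := natAbs_of_mem_signedWords hw hk; omega
    have hzz : z = z' := by
      have : z ∈ insertWord g' [z'] w' := by rw [← he]; simp [insertWord]
      rw [(insertWord_perm _ _ _).mem_iff, List.mem_append, List.mem_singleton] at this
      exact this.resolve_left (hn hp'.1 hp.2.1)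
    subst hzz
    have hl := length_of_mem_signedWords hp.1
    have hl' := length_of_mem_signedWords hp'.1
    obtain ⟨rfl, rfl⟩ := insertWord_singleton_inj (hn hp.1 hp.2.1) (hn hp'.1 hp.2.1)
      (by omega) (by omega) he
    rfl
  · intro v hv
    obtain ⟨w, hw, g, hg, z, hzn, rfl⟩ := exists_eq_insertWord_of_mem_signedWords hv
    exact ⟨(w, z, g), by simp only [Finset.mem_product, hz, Finset.mem_range]; tauto, rfl⟩

/-! ### Statistics of a signed word under insertion of a letter -/

/-- The number of descents of a word of integers. -/
def wordDes (w : List ℤ) : ℕ :=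
  ∑ i ∈ Finset.Ico 1 w.length, if entry w i > entry w (i + 1) then 1 else 0

/-- A word starts with a positive letter. -/
def startsPositive (w : List ℤ) : Bool := decide (0 < entry w 1)

/-- The number of negative letters of a word. -/
def wordNeg (w : List ℤ) : ℕ := w.countP (· < 0)

/-- The value of `f` at the statistics of a signed permutation. -/
def signedValue {R : Type*} (f : ℕ → Bool → ℕ → R) (w : List ℤ) : R :=
  f (wordDes w + 1) (startsPositive w) (wordNeg w)

/-- The comparison across gap `g` is replaced by two comparisons with `z`; at either end of the
word, the missing neighbour contributes nothing. -/
theorem sum_descents_insert {s s' : ℕ → ℤ} {z : ℤ} {g N : ℕ} (hg : g ≤ N)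
    (hs' : ∀ i, s' i = if i ≤ g then s i else if i ≤ g + 1 then z else s (i - 1)) :
    (∑ i ∈ Finset.Ico 1 (N + 1), if s' i > s' (i + 1) then 1 else 0) +
        (if 1 ≤ g ∧ g < N ∧ s g > s (g + 1) then 1 else 0) =
      (∑ i ∈ Finset.Ico 1 N, if s i > s (i + 1) then 1 else 0) +
        ((if 1 ≤ g ∧ s g > z then 1 else 0) + (if g < N ∧ z > s (g + 1) then 1 else 0)) := by
  induction N, hg using Nat.le_induction with
  | base =>
    simp only [lt_irrefl, false_and, and_false, if_false, add_zero]
    rcases Nat.eq_zero_or_pos g with rfl | hg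
    · simp
    · rw [Finset.sum_Ico_succ_top hg]
      congr 1
      · refine Finset.sum_congr rfl fun i hi => ?_
        rw [Finset.mem_Ico] at hi
        simp only [hs', show i ≤ g by omega, show i + 1 ≤ g by omega, if_true]
      · simp [hs', show 1 ≤ g from hg]
  | succ N hN ih =>
    rw [Finset.sum_Ico_succ_top (by omega)]
    have hlt : g < N + 1 := by omega
    -- When `N = g` the inserted letter, last until now, acquires a right neighbour; later steps
    -- only add a shifted old comparison.
    rcases hN.eq_or_lt with rfl | hN
    · simp only [lt_irrefl, false_and, and_false, if_false, add_zero, true_and, hlt] at ih ⊢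
      have e : (s' (g + 1) > s' (g + 1 + 1)) ↔ z > s (g + 1) := by simp [hs']
      rw [if_congr e rfl rfl]
      rcases Nat.eq_zero_or_pos g with rfl | hg
      · simp
      · rw [Finset.sum_Ico_succ_top (by omega) (fun i => if s i > s (i + 1) then 1 else 0)]
        simp only [show 1 ≤ g from hg, true_and] at ih ⊢
        omega
    · rw [Finset.sum_Ico_succ_top (by omega) (fun i => if s i > s (i + 1) then 1 else 0)]
      have e : (s' (N + 1) > s' (N + 1 + 1)) ↔ s N > s (N + 1) := by
        simp only [hs']
        rw [if_neg (by omega), if_neg (by omega), if_neg (by omega), if_neg (by omega)]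
        simp
      rw [if_congr e rfl rfl]
      simp only [hN, hlt, true_and] at ih ⊢
      omega

theorem entry_insertWord_singleton {g : ℕ} {w : List ℤ} (z : ℤ) (hg : g ≤ w.length) (i : ℕ) :
    entry (insertWord g [z] w) i =
      if i ≤ g then entry w i else if i ≤ g + 1 then z else entry w (i - 1) := by
  rw [entry_insertWord _ _ hg]
  simp only [List.length_cons, List.length_nil]
  split_ifs with h1 h2 <;> try rfl
  simp [show i - g - 1 = 0 by omega]

theorem wordDes_insertWord {g : ℕ} {w : List ℤ} (z : ℤ) (hg : g ≤ w.length) :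
    wordDes (insertWord g [z] w) +
        (if 1 ≤ g ∧ g < w.length ∧ entry w g > entry w (g + 1) then 1 else 0) =
      wordDes w + ((if 1 ≤ g ∧ entry w g > z then 1 else 0) +
        (if g < w.length ∧ z > entry w (g + 1) then 1 else 0)) := by
  rw [wordDes, length_insertWord]
  exact sum_descents_insert hg (entry_insertWord_singleton z hg)

theorem startsPositive_insertWord {g : ℕ} {w : List ℤ} (z : ℤ) (hg : g ≤ w.length) :
    startsPositive (insertWord g [z] w) = if g = 0 then decide (0 < z) else startsPositive w := by
  simp only [startsPositive, entry_insertWord_singleton z hg]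
  rcases Nat.eq_zero_or_pos g with rfl | h
  · simp
  · simp [show 1 ≤ g from h, h.ne']

theorem wordNeg_insertWord (g : ℕ) (w : List ℤ) (z : ℤ) :
    wordNeg (insertWord g [z] w) = wordNeg w + if z < 0 then 1 else 0 := by
  rw [wordNeg, (insertWord_perm g [z] w).countP_eq, List.countP_append, wordNeg]
  simp [List.countP_cons]

theorem sum_range_succ_eq_add_Ico {R : Type*} [AddCommMonoid R] (F : ℕ → R) {N : ℕ} (hN : 1 ≤ N) :
    ∑ g ∈ Finset.range (N + 1), F g = F 0 + F N + ∑ g ∈ Finset.Ico 1 N, F g := by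
  rw [Finset.sum_range_succ, Finset.range_eq_Ico, Finset.sum_eq_sum_Ico_succ_bot (by omega)]
  abel

theorem sum_signedValue_insertWord {R : Type*} [AddCommMonoid R] (f : ℕ → Bool → ℕ → R)
    {n : ℕ} (hn : 1 ≤ n) {w : List ℤ} (hw : w ∈ signedWords n) :
    ∑ g ∈ Finset.range (n + 1), signedValue f (insertWord g [(n + 1 : ℤ)] w) +
        ∑ g ∈ Finset.range (n + 1), signedValue f (insertWord g [-(n + 1 : ℤ)] w) =
      signedValue (insertionStep (n + 1) f) w := by
  have hlen := length_of_mem_signedWords hw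
  have hent : ∀ i, -(n + 1 : ℤ) < entry w i ∧ entry w i < n + 1 := fun i => by
    by_cases h : 1 ≤ i ∧ i ≤ w.length
    · have := natAbs_of_mem_signedWords hw (entry_mem h.1 h.2)
      omega
    · have : entry w i = 0 := by
        by_cases hi : i = 0
        · subst hi; rfl
        · exact entry_of_length_lt (by omega)
      omega
  have hd : (∑ i ∈ Finset.Ico 1 n, if entry w i > entry w (i + 1) then 1 else 0) = wordDes w := by
    rw [wordDes, hlen]
  have hdle : wordDes w + 1 ≤ n := by
    rw [← hd, Finset.sum_boole, Nat.cast_id]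
    have := Finset.card_filter_le (Finset.Ico 1 n) (fun i => entry w i > entry w (i + 1))
    rw [Nat.card_Ico] at this
    omega
  -- A new maximum creates a descent unless it is last, and absorbs a descent already at its gap. `1
  -- ≤ g` keeps the default `entry w 0 = 0` from counting as a letter.
  have hP : ∀ g ≤ n, wordDes (insertWord g [(n + 1 : ℤ)] w) =
      if g = n ∨ 1 ≤ g ∧ entry w g > entry w (g + 1) then wordDes w else wordDes w + 1 :=
    fun g hg => by
      have := wordDes_insertWord (n + 1 : ℤ) (show g ≤ w.length by omega)
      have h1 := (hent g).2
      have h2 := (hent (g + 1)).2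
      rw [hlen] at this
      split_ifs at this ⊢ <;> omega
  -- Dually, a new minimum creates a descent unless it is first; `g < n` excludes the default 0
  -- after the last letter.
  have hN : ∀ g ≤ n, wordDes (insertWord g [-(n + 1 : ℤ)] w) =
      if g = 0 ∨ g < n ∧ entry w g > entry w (g + 1) then wordDes w else wordDes w + 1 :=
    fun g hg => by
      have := wordDes_insertWord (-(n + 1 : ℤ)) (show g ≤ w.length by omega)
      have h1 := (hent g).1
      have h2 := (hent (g + 1)).1
      rw [hlen] at this
      split_ifs at this ⊢ <;> omega
  have hpos : ∀ g ≤ n, signedValue f (insertWord g [(n + 1 : ℤ)] w) =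
      f ((if g = n ∨ 1 ≤ g ∧ entry w g > entry w (g + 1) then wordDes w else wordDes w + 1) + 1)
        (if g = 0 then true else startsPositive w) (wordNeg w) := fun g hg => by
    rw [signedValue, hP g hg, startsPositive_insertWord _ (by omega), wordNeg_insertWord,
      if_neg (by omega : ¬ (n + 1 : ℤ) < 0), decide_eq_true (by omega : 0 < (n + 1 : ℤ)), add_zero]
  have hneg : ∀ g ≤ n, signedValue f (insertWord g [-(n + 1 : ℤ)] w) =
      f ((if g = 0 ∨ g < n ∧ entry w g > entry w (g + 1) then wordDes w else wordDes w + 1) + 1)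
        (if g = 0 then false else startsPositive w) (wordNeg w + 1) := fun g hg => by
    rw [signedValue, hN g hg, startsPositive_insertWord _ (by omega), wordNeg_insertWord,
      if_pos (by omega : -(n + 1 : ℤ) < 0), decide_eq_false (by omega : ¬ 0 < -(n + 1 : ℤ))]
  -- The end gaps are treated apart; they are distinct because `1 ≤ n`.
  rw [sum_range_succ_eq_add_Ico _ hn, sum_range_succ_eq_add_Ico _ hn, hpos 0 (by omega),
    hpos n le_rfl, hneg 0 (by omega), hneg n le_rfl, signedValue]
  have hIp : ∑ g ∈ Finset.Ico 1 n, signedValue f (insertWord g [(n + 1 : ℤ)] w) =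
      ∑ g ∈ Finset.Ico 1 n, if entry w g > entry w (g + 1) then
        f (wordDes w + 1) (startsPositive w) (wordNeg w)
        else f (wordDes w + 1 + 1) (startsPositive w) (wordNeg w) := by
    refine Finset.sum_congr rfl fun g hg => ?_
    rw [Finset.mem_Ico] at hg
    rw [hpos g (by omega), if_neg (by omega : ¬ g = 0)]
    simp only [hg.1, hg.2.ne, false_or, true_and]
    split_ifs <;> rfl
  have hIn : ∑ g ∈ Finset.Ico 1 n, signedValue f (insertWord g [-(n + 1 : ℤ)] w) =
      ∑ g ∈ Finset.Ico 1 n, if entry w g > entry w (g + 1) then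
        f (wordDes w + 1) (startsPositive w) (wordNeg w + 1)
        else f (wordDes w + 1 + 1) (startsPositive w) (wordNeg w + 1) := by
    refine Finset.sum_congr rfl fun g hg => ?_
    rw [Finset.mem_Ico] at hg
    rw [hneg g (by omega), if_neg (by omega : ¬ g = 0)]
    simp only [show ¬ g = 0 by omega, hg.2, false_or, true_and]
    split_ifs <;> rfl
  rw [hIp, hIn, sum_ite_const _ _ _ _ hd, sum_ite_const _ _ _ _ hd, Nat.card_Ico, insertionStep]
  generalize wordDes w = d at *
  generalize wordNeg w = e at *
  have hn0 : ¬ n = 0 := by omega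
  simp only [hn0, Ne.symm hn0, if_true, if_false, true_or, lt_irrefl, false_and, or_self,
    show ¬ (1 ≤ 0) by omega]
  -- `c` is the number of ascents among the `n - 1` inner gaps.
  obtain ⟨c, rfl⟩ : ∃ c, n = d + 1 + c := ⟨n - (d + 1), by omega⟩
  rw [show d + 1 + c + 1 - (d + 1) = c + 1 by omega, show d + 1 + c - 1 - d = c by omega]
  simp only [Nat.add_sub_cancel]
  cases startsPositive w
  · simp only [cond_false, succ_nsmul]
    abel
  · simp only [cond_true, succ_nsmul]
    abel

theorem sum_signedValue_succ {R : Type*} [AddCommMonoid R] (f : ℕ → Bool → ℕ → R) {n : ℕ}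
    (hn : 1 ≤ n) :
    ∑ v ∈ signedWords (n + 1), signedValue f v =
      ∑ w ∈ signedWords n, signedValue (insertionStep (n + 1) f) w := by
  rw [sum_signedWords_succ]
  exact Finset.sum_congr rfl fun w hw => sum_signedValue_insertWord f hn hw

theorem sum_signedValue_one {R : Type*} [AddCommMonoid R] (f : ℕ → Bool → ℕ → R) :
    ∑ v ∈ signedWords 1, signedValue f v = f 1 true 0 + f 1 false 1 := by
  have h0 : signedWords 0 = {[]} := by
    ext w
    rw [mem_signedWords, Finset.mem_singleton]
    simp
  rw [sum_signedWords_succ, h0, Finset.sum_singleton, Finset.sum_range_one, Finset.sum_range_one]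
  rfl

/-! ### Equidistribution and return to the original statistics -/

/-- The function `f` must stay universally quantified: the induction hypothesis is used for
`insertionStep (n + 1) f`. The induction starts at 1, since the empty signed word does not fit the
recursion. -/
theorem sum_signedValue_eq_sum_stirlingValue {R : Type*} [AddCommMonoid R] {n : ℕ} (hn : 1 ≤ n) :
    ∀ f : ℕ → Bool → ℕ → R, ∑ w ∈ signedWords n, signedValue f w =
      ∑ σ ∈ stirlingZero (n + 1), stirlingValue f σ := by
  induction n, hn using Nat.le_induction with
  | base => exact fun f => (sum_signedValue_one f).trans (sum_stirlingValue_two f).symm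
  | succ n hn ih =>
    exact fun f => by rw [sum_signedValue_succ f hn, ih, sum_stirlingValue_succ f (by omega)]

theorem wordDes_signedWord {n : ℕ} (π : Equiv.Perm (PlusMinus n)) :
    wordDes (signedWord π) = desA π := by
  simp only [wordDes, length_signedWord, entry_signedWord]
  rw [Finset.sum_boole, Nat.cast_id, desA]

/-- The only extra type B descent is at 0, present exactly when the first letter is negative. -/
theorem desB_eq {n : ℕ} (hn : 1 ≤ n) (π : Equiv.Perm (PlusMinus n)) :
    desB π = desA π + 1 - cond (startsPositive (signedWord π)) 1 0 := by
  have h0 : signedEntry π 0 = 0 := rfl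
  have h1 : signedEntry π 1 ≠ 0 := by
    rw [signedEntry, dif_pos (by omega)]
    exact (Finset.mem_erase.1 (Subtype.prop _)).1
  have : desB π = desA π + if 0 > signedEntry π 1 then 1 else 0 := by
    rw [desB, desA, Finset.card_filter, Finset.card_filter, Finset.range_eq_Ico,
      Finset.sum_eq_sum_Ico_succ_bot (by omega), add_comm, zero_add, h0]
  rw [this, startsPositive, entry_signedWord]
  by_cases h : 0 < signedEntry π 1
  · rw [decide_eq_true h, if_neg (by omega)]
    simp
  · rw [decide_eq_false h, if_pos (by omega)]
    simp

theorem wordNeg_eq_sum (w : List ℤ) :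
    wordNeg w = ∑ i ∈ Finset.range w.length, if entry w (i + 1) < 0 then 1 else 0 := by
  induction w with
  | nil => rfl
  | cons z w ih =>
    rw [wordNeg] at ih ⊢
    rw [List.countP_cons, ih, List.length_cons, Finset.sum_range_succ']
    simp [entry]

theorem wordNeg_signedWord {n : ℕ} (π : Equiv.Perm (PlusMinus n)) :
    wordNeg (signedWord π) = negCount π := by
  simp only [wordNeg_eq_sum, length_signedWord, entry_signedWord]
  rw [negCount, Finset.card_filter, Finset.range_eq_Ico,
    Finset.sum_Ico_add' (fun i => if signedEntry π i < 0 then 1 else 0)]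
  rfl

/-- Only position 1 separates the two counts, and there the ascent from `σ_0 = 0` is automatic. -/
theorem ap_eq {m : ℕ} (hm : 2 ≤ m) {σ : List ℕ} (hσ : σ ∈ stirlingZero m) :
    ap σ = lap σ - cond (startsWithPlateau σ) 1 0 := by
  have hlen := length_of_mem_stirlingZero (by omega) hσ
  have hne : σ ≠ [] := by
    rintro rfl
    simp at hlen
    omega
  have h1 := isLapAt_one_iff (fun k hk => (lt_of_mem_stirlingZero (by omega) hσ hk).1) hne
  have : lap σ = (if IsLapAt (entry σ) 1 then 1 else 0) + ap σ := by
    rw [lap, ap, Finset.card_filter, Finset.card_filter,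
      Finset.sum_eq_sum_Ico_succ_bot (by omega)]
    rfl
  rw [this, if_congr h1 rfl rfl]
  cases startsWithPlateau σ <;> simp

theorem mainTheorem3 {R : Type*} [CommSemiring R] (x y q : R) (n : ℕ) (hn : 1 ≤ n) :
    ∑ π ∈ signedPermutations n, x ^ (desA π + 1) * y ^ desB π * q ^ negCount π =
      ∑ σ ∈ stirlingZero (n + 1), x ^ lap σ * y ^ ap σ * q ^ evenCount σ := by
  have h := sum_signedValue_eq_sum_stirlingValue hn
    -- The exponent of `y` is `desB` on one side and `ap` on the other.
    (fun a t e => x ^ a * y ^ (a - cond t 1 0) * q ^ e)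
  rw [signedWords, Finset.sum_image (signedWord_injOn n)] at h
  refine Eq.trans (Finset.sum_congr rfl fun π _ => ?_)
    (h.trans (Finset.sum_congr rfl fun σ hσ => ?_))
  · rw [signedValue, wordDes_signedWord, wordNeg_signedWord, desB_eq hn]
  · rw [stirlingValue, ap_eq (by omega) hσ]
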